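/- Let $G$ be a finite simple planar graph with $n \ge 4$ vertices. Call two distinct cycles of $G$ adjacent if they have a common edge. If no triangle (cycle of length $3$) of $G$ is adjacent to a cycle of length $3$ or $5$, then $$|E(G)| \le 2(n-2).$$ -/

import Mathlib

/-- A drawing of the graph `G` in the Euclidean plane without crossings: the vertices are distinct
points, every edge is a simple (Jordan) arc joining its two ends, and the interior of an edge
contains no vertex and no point of any other edge. -/
structure SimpleGraph.PlaneDrawing {V : Type*} (G : SimpleGraph V) where
  /-- the point that represents a vertex -/
  point : V → EuclideanSpace ℝ (Fin 2)
  /-- a parametrization of the arc that represents an edge -/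
  arc : G.edgeSet → unitInterval → EuclideanSpace ℝ (Fin 2)
  point_injective : Function.Injective point
  arc_continuous : ∀ e, Continuous (arc e)
  arc_injective : ∀ e, Function.Injective (arc e)
  arc_ends : ∀ e, s(arc e 0, arc e 1) = Sym2.map point (e : Sym2 V)
  arc_ne_point : ∀ e, ∀ t ∈ Set.Ioo (0 : unitInterval) 1, ∀ v, arc e t ≠ point v
  arc_ne_arc : ∀ e f, e ≠ f → ∀ s ∈ Set.Ioo (0 : unitInterval) 1,
    ∀ t ∈ Set.Ioo (0 : unitInterval) 1, arc e s ≠ arc f t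

/-- A graph is planar if it can be drawn in the plane without crossings. -/
def SimpleGraph.IsPlanar {V : Type*} (G : SimpleGraph V) : Prop :=
  Nonempty G.PlaneDrawing

/-- Two cycles, given by closed walks, are adjacent if they are different cycles (as subgraphs, so
that the starting vertex and the direction of the walks do not matter) and have a common edge. -/
def SimpleGraph.AdjacentCycles {V : Type*} {G : SimpleGraph V} {u v : V}
    (c : G.Walk u u) (d : G.Walk v v) : Prop :=
  c.IsCycle ∧ d.IsCycle ∧ c.toSubgraph ≠ d.toSubgraph ∧ ∃ e, e ∈ c.edges ∧ e ∈ d.edges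

/-- Some triangle of `G` is adjacent to some cycle of length `k` of `G`. -/
def SimpleGraph.HasTriangleAdjacentToCycle {V : Type*} (G : SimpleGraph V) (k : ℕ) : Prop :=
  ∃ (u v : V) (c : G.Walk u u) (d : G.Walk v v),
    c.length = 3 ∧ d.length = k ∧ SimpleGraph.AdjacentCycles c d

/-!
Off a simple arc from `a` to `b` in `ℂ` there is a continuous branch of `√((z - a) (z - b))`, and
it changes sign across the arc. This replaces the Jordan curve theorem: comparing the signs of the
branches attached to all edges labels each point off the drawing by a vector over `ZMod 2`, taken
in the edge space modulo the cut space.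

* The labels on the two sides of an edge `e` differ by the class of `e`. These classes span a space
  of the dimension of the cycle space, so there are at least `E - V + 2` faces.
* Given a function of the labels, the product of the branches of the edges across which it jumps,
  with suitable signs, extends continuously to the complement of the vertices. Near a vertex `v`
  its square is `(z - v) ^ k` times a nonvanishing continuous factor, where `k` is the number of
  these edges at `v`, so `k` is even: face boundaries are even edge sets.

A nonempty even set of at most five edges is a single cycle, so a triangular face borders only
faces of length at least `6` (a quadrilateral through an edge of a triangle would yield a triangle
or a pentagon through another one). Hence an edge can pay every face that it borders, in such a way
that every face gets at least `12` and every edge pays at most `6`: then `2 F ≤ E`, which with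
`E - V + 2 ≤ F` gives the bound.
-/

open Filter Topology

local notation "χ" => (ZMod.stdAddChar : AddChar (ZMod 2) ℂ)

section SquareRoots

theorem exists_exp_eq_div_sub (γ : C(unitInterval, ℂ)) :
    ∃ l : C(((Set.range γ)ᶜ : Set ℂ), ℂ), ∀ z, Complex.exp (l z) = (z - γ 1) / (z - γ 0) := by
  have hne (t : unitInterval) (z : ((Set.range γ)ᶜ : Set ℂ)) : (z : ℂ) - γ t ≠ 0 :=
    fun h => z.2 ⟨t, (sub_eq_zero.1 h).symm⟩
  let H : C(unitInterval × ((Set.range γ)ᶜ : Set ℂ), {z : ℂ // z ≠ 0}) :=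
    ⟨fun x => ⟨((x.2 : ℂ) - γ x.1) / (x.2 - γ 0), div_ne_zero (hne _ _) (hne _ _)⟩,
      Continuous.subtype_mk (Continuous.div (by fun_prop) (by fun_prop) fun x => hne _ _) _⟩
  have hzero (z) : H (0, z) = ⟨Complex.exp ((0 : C(_, ℂ)) z), Complex.exp_ne_zero _⟩ :=
    Subtype.ext <| by simp [H, div_self (hne 0 z)]
  let L := Complex.isCoveringMap_exp.liftHomotopy H 0 hzero
  refine ⟨⟨fun z => L (1, z), by fun_prop⟩, fun z => congrArg Subtype.val <|
    congrFun (Complex.isCoveringMap_exp.liftHomotopy_lifts H 0 hzero) (1, z)⟩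

theorem exists_continuousOn_sqrt_compl_range (γ : C(unitInterval, ℂ)) :
    ∃ σ : ℂ → ℂ, ContinuousOn σ (Set.range γ)ᶜ ∧
      ∀ z ∉ Set.range γ, σ z ^ 2 = (z - γ 0) * (z - γ 1) := by
  obtain ⟨l, hl⟩ := exists_exp_eq_div_sub γ
  let σ : ((Set.range γ)ᶜ : Set ℂ) → ℂ := fun z => Complex.exp (l z / 2) * (z - γ 0)
  have hσ : Subtype.val.extend σ 0 ∘ Subtype.val = σ :=
    Function.extend_comp Subtype.val_injective σ 0
  refine ⟨Subtype.val.extend σ 0, ?_, fun z hz => ?_⟩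
  · rw [continuousOn_iff_continuous_domRestrict]
    exact (show Continuous σ by fun_prop).congr fun z => (congrFun hσ z).symm
  · have hz0 : z - γ 0 ≠ 0 := fun h => hz ⟨0, (sub_eq_zero.1 h).symm⟩
    rw [show Subtype.val.extend σ 0 z = σ ⟨z, hz⟩ from congrFun hσ ⟨z, hz⟩, mul_pow,
      ← Complex.exp_nat_mul, Nat.cast_two, mul_div_cancel₀ _ two_ne_zero, hl]
    field_simp

theorem exists_sq_eq_of_ne_zero {X : Type*} [TopologicalSpace X] {f : X → ℂ} (hf : Continuous f)
    {x₀ : X} (h₀ : f x₀ ≠ 0) :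
    ∃ ρ : X → ℂ, (∀ᶠ x in 𝓝 x₀, ContinuousAt ρ x) ∧ ∀ x, ρ x ^ 2 = f x := by
  have hdiv : Continuous fun x => f x / f x₀ := hf.div_const _
  have hslit : ∀ᶠ x in 𝓝 x₀, f x / f x₀ ∈ Complex.slitPlane :=
    hdiv.continuousAt.eventually_mem <| Complex.isOpen_slitPlane.mem_nhds <| by
      simp [div_self h₀]
  refine ⟨fun x => f x₀ ^ (1 / 2 : ℂ) * (f x / f x₀) ^ (1 / 2 : ℂ), ?_, fun x => ?_⟩
  · filter_upwards [hslit] with x hx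
    exact continuousAt_const.mul (hdiv.continuousAt.cpow continuousAt_const hx)
  · rw [mul_pow, ← Complex.cpow_nat_mul, ← Complex.cpow_nat_mul, Nat.cast_two,
      mul_one_div_cancel two_ne_zero, Complex.cpow_one, Complex.cpow_one, mul_div_cancel₀ _ h₀]

theorem eventuallyEq_of_sq_eq {X K : Type*} [TopologicalSpace X] [Field K] [NeZero (2 : K)]
    [TopologicalSpace K] [ContinuousAdd K] [T1Space K] {f g : X → K} {x₀ : X}
    (hf : ContinuousAt f x₀) (hg : ContinuousAt g x₀) (hsq : ∀ᶠ x in 𝓝 x₀, f x ^ 2 = g x ^ 2)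
    (h : f x₀ = g x₀) (h₀ : g x₀ ≠ 0) : f =ᶠ[𝓝 x₀] g := by
  have hsum : ∀ᶠ x in 𝓝 x₀, f x + g x ≠ 0 := (hf.add hg).eventually_ne <| by
    rw [Pi.add_apply, h, ← two_mul]
    exact mul_ne_zero two_ne_zero h₀
  filter_upwards [hsq, hsum] with x hx hx0
  exact (sq_eq_sq_iff_eq_or_eq_neg.1 hx).resolve_right fun hneg =>
    hx0 (by rw [hneg, neg_add_cancel])

theorem even_of_sq_eq_mul_exp {q : ℝ → ℂ} (hq : Continuous q)
    (hper : Function.Periodic q (2 * Real.pi)) {a : ℂ} (ha : a ≠ 0) {n : ℕ}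
    (hsq : ∀ θ : ℝ, q θ ^ 2 = a * Complex.exp (n * (θ * Complex.I))) : Even n := by
  let g : ℝ → ℂ := fun θ => q 0 * Complex.exp (n * (θ * Complex.I) / 2)
  have hq0 : q 0 ^ 2 = a := by simpa using hsq 0
  have hq0_ne : q 0 ≠ 0 := by
    intro h
    exact ha (by rw [← hq0, h, zero_pow two_ne_zero])
  have hqg : Set.EqOn q g Set.univ := by
    refine isPreconnected_univ.eq_of_sq_eq hq.continuousOn (by fun_prop) (fun θ _ => ?_)
      (fun _ => mul_ne_zero hq0_ne (Complex.exp_ne_zero _)) (Set.mem_univ 0) (by simp [g])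
    simp only [Pi.pow_apply, g, mul_pow]
    rw [hsq, hq0, ← Complex.exp_nat_mul, Nat.cast_two, mul_div_cancel₀ _ two_ne_zero]
  have hturn : q 0 * (-1) ^ n = q 0 := by
    calc q 0 * (-1) ^ n = g (2 * Real.pi) := by
          rw [← Complex.exp_pi_mul_I, ← Complex.exp_nat_mul]
          simp only [g]
          push_cast
          ring_nf
      _ = q (2 * Real.pi) := (hqg (Set.mem_univ _)).symm
      _ = q 0 := by simpa using hper 0
  exact (neg_one_pow_eq_one_iff_even (R := ℂ) (by norm_num)).1
    (mul_left_cancel₀ hq0_ne (hturn.trans (mul_one _).symm))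

theorem even_of_eventually_sq_eq {s h : ℂ → ℂ} {v : ℂ} {n : ℕ}
    (hs : ∀ᶠ z in 𝓝[≠] v, ContinuousAt s z) (hh : Continuous h) (hv : h v ≠ 0)
    (hsq : ∀ᶠ z in 𝓝[≠] v, s z ^ 2 = (z - v) ^ n * h z) : Even n := by
  obtain ⟨ρ, hρ, hρsq⟩ := exists_sq_eq_of_ne_zero hh hv
  have hnear : ∀ᶠ z in 𝓝[≠] v, ContinuousAt s z ∧ s z ^ 2 = (z - v) ^ n * h z ∧
      ContinuousAt ρ z ∧ h z ≠ 0 := by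
    filter_upwards [hs, hsq, hρ.filter_mono nhdsWithin_le_nhds,
      (hh.continuousAt.eventually_ne hv).filter_mono nhdsWithin_le_nhds]
      with z h₁ h₂ h₃ h₄ using ⟨h₁, h₂, h₃, h₄⟩
  obtain ⟨ε, hε, hball⟩ := Metric.eventually_nhds_iff.1 (eventually_nhdsWithin_iff.1 hnear)
  let c : ℝ → ℂ := circleMap v (ε / 2)
  have hc (θ : ℝ) := hball (y := c θ)
    (by simp [c, dist_eq_norm, abs_of_pos (half_pos hε), hε])
    (circleMap_ne_center (half_pos hε).ne')
  have hρ0 (θ : ℝ) : ρ (c θ) ≠ 0 := fun h0 => (hc θ).2.2.2 <| by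
    rw [← hρsq, h0, zero_pow two_ne_zero]
  refine even_of_sq_eq_mul_exp (q := fun θ => s (c θ) / ρ (c θ)) (a := ((ε / 2 : ℝ) : ℂ) ^ n)
    ?_ (fun θ => ?_) (pow_ne_zero _ (by exact_mod_cast (half_pos hε).ne')) fun θ => ?_
  · rw [continuous_iff_continuousAt]
    intro θ
    have hcθ : ContinuousAt c θ := (continuous_circleMap v (ε / 2)).continuousAt
    exact ((hc θ).1.comp hcθ).div ((hc θ).2.2.1.comp hcθ) (hρ0 θ)
  · simp only [c, periodic_circleMap v (ε / 2) θ]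
  · rw [div_pow, (hc θ).2.1, hρsq, mul_div_cancel_right₀ _ (hc θ).2.2.2, circleMap_sub_center,
      circleMap_zero, mul_pow, ← Complex.exp_nat_mul]

end SquareRoots

section Arcs

variable {F : Type*} [NormedAddCommGroup F] [NormedSpace ℝ F]

theorem isPreconnected_ball_diff_center (hF : 1 < Module.rank ℝ F) (c : F) {r : ℝ} (hr : 0 < r) :
    IsPreconnected (Metric.ball c r \ {c}) := by
  let φ := OpenPartialHomeomorph.univBall c r
  have himage : φ '' {0}ᶜ = Metric.ball c r \ {c} := by
    have hsource : φ.source = Set.univ := OpenPartialHomeomorph.univBall_source c r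
    have hinj : Function.Injective φ := Set.injOn_univ.1 (hsource ▸ φ.injOn)
    rw [Set.image_compl_eq_range_sdiff_image hinj, Set.image_singleton, ← Set.image_univ, ← hsource,
      φ.image_source_eq_target, OpenPartialHomeomorph.univBall_target c hr,
      OpenPartialHomeomorph.univBall_apply_zero]
  rw [← himage]
  exact (isConnected_compl_singleton_of_one_lt_rank hF 0).isPreconnected.image _
    (OpenPartialHomeomorph.continuous_univBall c r).continuousOn

theorem interior_range_eq_empty_of_injective (hF : 1 < Module.rank ℝ F) {γ : unitInterval → F}
    (hγ : Continuous γ) (hinj : Function.Injective γ) : interior (Set.range γ) = ∅ := by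
  by_contra hne
  obtain ⟨_, hz⟩ := Set.nonempty_iff_ne_empty.2 hne
  obtain ⟨t₀, rfl⟩ := interior_subset hz
  have hdense : Dense (Set.Ioo (0 : unitInterval) 1) := by
    rw [dense_iff_closure_eq, closure_Ioo zero_ne_one, ← unitInterval.univ_eq_Icc]
  obtain ⟨t, ht, htmem⟩ := hdense.exists_mem_open (isOpen_interior.preimage hγ) ⟨t₀, hz⟩
  obtain ⟨r, hr, hball⟩ := Metric.isOpen_iff.1 isOpen_interior _ htmem
  -- Removing `t` disconnects the preimage of the ball, while a punctured ball is connected.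
  have hord : (γ ⁻¹' (Metric.ball (γ t) r \ {γ t})).OrdConnected :=
    ((isPreconnected_ball_diff_center hF _ hr).preimage_of_isClosedMap hinj
      (hγ.isClosedEmbedding hinj).isClosedMap
      (Set.sdiff_subset.trans (hball.trans interior_subset))).ordConnected
  have hnhds : γ ⁻¹' Metric.ball (γ t) r ∈ 𝓝 t := hγ.continuousAt (Metric.ball_mem_nhds _ hr)
  obtain ⟨l, hl, hlt⟩ := exists_Ioc_subset_of_mem_nhds hnhds ⟨0, ht.1⟩
  obtain ⟨u, hu, htu⟩ := exists_Ico_subset_of_mem_nhds hnhds ⟨1, ht.2⟩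
  obtain ⟨a, hla, hat⟩ := exists_between hl
  obtain ⟨b, htb, hbu⟩ := exists_between hu
  have hmem := hord.out (x := a) (y := b) ⟨hlt ⟨hla, hat.le⟩, fun h => hat.ne (hinj h)⟩
    ⟨htu ⟨htb.le, hbu⟩, fun h => htb.ne' (hinj h)⟩ ⟨hat.le, htb.le⟩
  exact hmem.2 rfl

theorem dense_compl_iUnion_range {E : Type*} [Finite E] (hF : 1 < Module.rank ℝ F)
    {γ : E → unitInterval → F} (hγ : ∀ e, Continuous (γ e))
    (hinj : ∀ e, Function.Injective (γ e)) : Dense (⋃ e, Set.range (γ e))ᶜ := by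
  rw [Set.compl_iUnion, ← Set.sInter_range]
  refine (Set.finite_range _).dense_sInter (Set.forall_mem_range.2 fun e => ?_)
    (Set.forall_mem_range.2 fun e => ?_)
  · exact (isCompact_range (hγ e)).isClosed.isOpen_compl
  · rw [← interior_eq_empty_iff_dense_compl]
    exact interior_range_eq_empty_of_injective hF (hγ e) (hinj e)

end Arcs

section Signs

theorem addChar_sum_eq_prod {ι A M : Type*} [AddCommMonoid A] [CommMonoid M] (ψ : AddChar A M)
    (s : Finset ι) (f : ι → A) : ψ (∑ i ∈ s, f i) = ∏ i ∈ s, ψ (f i) :=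
  (congrArg ψ.toMonoidHom (ofAdd_sum s f)).trans (map_prod ψ.toMonoidHom _ s)

theorem stdAddChar_two_one : χ 1 = -1 := by
  have := ZMod.stdAddChar_coe (N := 2) 1
  rw [Int.cast_one] at this
  rw [this, ← Complex.exp_pi_mul_I]
  push_cast
  ring_nf

theorem stdAddChar_two_sq (x : ZMod 2) : χ x ^ 2 = 1 := by
  rw [← AddChar.map_nsmul_eq_pow, CharTwo.two_nsmul, AddChar.map_zero_eq_one]

theorem stdAddChar_two_ne_zero (x : ZMod 2) : χ x ≠ 0 := fun h => by
  simpa [h] using stdAddChar_two_sq x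

theorem zmod_two_eq_zero_or_eq_one : ∀ x : ZMod 2, x = 0 ∨ x = 1 := by decide

theorem exists_eq_stdAddChar_two_mul {u v : ℂ} (h : u ^ 2 = v ^ 2) : ∃ x, u = χ x * v := by
  rcases sq_eq_sq_iff_eq_or_eq_neg.1 h with h | h
  · exact ⟨0, by rw [h, AddChar.map_zero_eq_one, one_mul]⟩
  · exact ⟨1, by rw [h, stdAddChar_two_one, neg_one_mul]⟩

end Signs

section Discharging

/-- The weight of every edge in the boundary of a face of length `n`. Every face gets at least `12`
in total, while two adjacent faces give at most `6` to a common edge if triangles are adjacent only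
to faces of length at least `6`. -/
def edgeWeight (n : ℕ) : ℕ := if n = 3 then 4 else if n < 6 then 3 else 2

theorem twelve_le_mul_edgeWeight {n : ℕ} (hn : 3 ≤ n) : 12 ≤ n * edgeWeight n := by
  unfold edgeWeight
  grind

theorem edgeWeight_le_four (n : ℕ) : edgeWeight n ≤ 4 := by
  unfold edgeWeight
  grind

theorem edgeWeight_add_edgeWeight_le_six {m n : ℕ} (hmn : m = 3 → 6 ≤ n) (hnm : n = 3 → 6 ≤ m) :
    edgeWeight m + edgeWeight n ≤ 6 := by
  unfold edgeWeight
  grind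

variable {ι E : Type*} [Fintype ι] {S : ι → Finset E}

theorem sum_edgeWeight_filter_mem_le_six [DecidableEq E]
    (hpair : ∀ i j k e, i ≠ j → e ∈ S i → e ∈ S j → e ∈ S k → k = i ∨ k = j)
    (htriangle : ∀ i j e, i ≠ j → e ∈ S i → e ∈ S j → (S i).card = 3 → 6 ≤ (S j).card) (e : E) :
    ∑ i with e ∈ S i, edgeWeight (S i).card ≤ 6 := by
  classical
  by_cases hcard : (Finset.univ.filter fun i => e ∈ S i).card ≤ 1
  · refine (Finset.sum_le_card_nsmul _ _ 4 fun i _ => edgeWeight_le_four _).trans ?_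
    rw [smul_eq_mul]
    lia
  · obtain ⟨i, hi, j, hj, hij⟩ := Finset.one_lt_card.1 (not_le.1 hcard)
    rw [Finset.mem_filter_univ] at hi hj
    have hfilter : (Finset.univ.filter fun i => e ∈ S i) ⊆ {i, j} := fun k hk => by
      simpa using hpair i j k e hij hi hj ((Finset.mem_filter_univ k).1 hk)
    calc
      _ ≤ ∑ k ∈ {i, j}, edgeWeight (S k).card := Finset.sum_le_sum_of_subset hfilter
      _ = edgeWeight (S i).card + edgeWeight (S j).card := Finset.sum_pair hij
      _ ≤ 6 := edgeWeight_add_edgeWeight_le_six (htriangle i j e hij hi hj)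
        (htriangle j i e hij.symm hj hi)

theorem two_mul_card_faces_le_card_edges [Fintype E] (hthree : ∀ i, 3 ≤ (S i).card)
    (hpair : ∀ i j k e, i ≠ j → e ∈ S i → e ∈ S j → e ∈ S k → k = i ∨ k = j)
    (htriangle : ∀ i j e, i ≠ j → e ∈ S i → e ∈ S j → (S i).card = 3 → 6 ≤ (S j).card) :
    2 * Fintype.card ι ≤ Fintype.card E := by
  classical
  have hcharge : Fintype.card ι * 12 ≤ Fintype.card E * 6 := calc
    Fintype.card ι * 12 ≤ ∑ i, (S i).card * edgeWeight (S i).card :=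
      Finset.card_nsmul_le_sum _ _ 12 fun i _ => twelve_le_mul_edgeWeight (hthree i)
    _ = ∑ i, ∑ _e ∈ S i, edgeWeight (S i).card := by simp only [Finset.sum_const, smul_eq_mul]
    _ = ∑ e, ∑ i with e ∈ S i, edgeWeight (S i).card := Finset.sum_comm' (by simp)
    _ ≤ Fintype.card E * 6 := Finset.sum_le_card_nsmul _ _ 6 fun e _ =>
      sum_edgeWeight_filter_mem_le_six hpair htriangle e
  lia

end Discharging

/-- A plane drawing of a loopless multigraph: simple arcs in the complex plane that meet at most at
their ends, each with a chosen direction. -/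
structure ArcSystem (V E : Type*) where
  /-- the points that represent the vertices -/
  pt : V → ℂ
  /-- the arcs that represent the edges -/
  arc : E → C(unitInterval, ℂ)
  /-- the vertex at which an arc starts -/
  src : E → V
  /-- the vertex at which an arc ends -/
  tgt : E → V
  pt_injective : Function.Injective pt
  arc_injective : ∀ e, Function.Injective (arc e)
  arc_zero : ∀ e, arc e 0 = pt (src e)
  arc_one : ∀ e, arc e 1 = pt (tgt e)
  arc_ne_pt : ∀ e, ∀ t ∈ Set.Ioo (0 : unitInterval) 1, ∀ v, arc e t ≠ pt v
  arc_ne_arc : ∀ e f, e ≠ f → ∀ s ∈ Set.Ioo (0 : unitInterval) 1,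
    ∀ t ∈ Set.Ioo (0 : unitInterval) 1, arc e s ≠ arc f t

namespace ArcSystem

variable {V E : Type*} (D : ArcSystem V E)

section Geometry

theorem src_ne_tgt (e : E) : D.src e ≠ D.tgt e := fun h =>
  zero_ne_one <| D.arc_injective e <| by rw [D.arc_zero, h, D.arc_one]

theorem arc_notMem_range_pt (e : E) {t : unitInterval} (ht : t ∈ Set.Ioo (0 : unitInterval) 1) :
    D.arc e t ∉ Set.range D.pt := fun ⟨v, hv⟩ => D.arc_ne_pt e t ht v hv.symm

theorem mem_Ioo_of_arc_notMem_range_pt {e : E} {t : unitInterval}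
    (h : D.arc e t ∉ Set.range D.pt) : t ∈ Set.Ioo (0 : unitInterval) 1 := by
  refine ⟨unitInterval.pos_iff_ne_zero.2 ?_, unitInterval.lt_one_iff_ne_one.2 ?_⟩
  · rintro rfl
    exact h ⟨_, (D.arc_zero e).symm⟩
  · rintro rfl
    exact h ⟨_, (D.arc_one e).symm⟩

theorem eq_of_mem_range_arc {e f : E} {z : ℂ} (hz : z ∉ Set.range D.pt)
    (he : z ∈ Set.range (D.arc e)) (hf : z ∈ Set.range (D.arc f)) : e = f := by
  obtain ⟨s, rfl⟩ := he
  obtain ⟨t, ht⟩ := hf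
  by_contra hne
  exact D.arc_ne_arc e f hne s (D.mem_Ioo_of_arc_notMem_range_pt hz) t
    (D.mem_Ioo_of_arc_notMem_range_pt (ht ▸ hz)) ht.symm

theorem arc_notMem_range_arc {e f : E} (hf : f ≠ e) {t : unitInterval}
    (ht : t ∈ Set.Ioo (0 : unitInterval) 1) : D.arc e t ∉ Set.range (D.arc f) :=
  fun h => hf (D.eq_of_mem_range_arc (D.arc_notMem_range_pt e ht) h ⟨t, rfl⟩)

theorem compl_range_arc_mem_nhds {e : E} {z : ℂ} (hz : z ∉ Set.range (D.arc e)) :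
    (Set.range (D.arc e))ᶜ ∈ 𝓝 z :=
  (isCompact_range (D.arc e).continuous).isClosed.isOpen_compl.mem_nhds hz

theorem compl_range_pt_mem_nhds [Finite V] {z : ℂ} (hz : z ∉ Set.range D.pt) :
    (Set.range D.pt)ᶜ ∈ 𝓝 z :=
  (Set.finite_range D.pt).isClosed.isOpen_compl.mem_nhds hz

/-- The complement of the drawing in the plane. -/
def outside : Set ℂ := (⋃ e, Set.range (D.arc e))ᶜ \ Set.range D.pt

theorem notMem_range_arc_of_mem_outside {z : ℂ} (hz : z ∈ D.outside) (e : E) :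
    z ∉ Set.range (D.arc e) := fun h => hz.1 (Set.mem_iUnion.2 ⟨e, h⟩)

theorem dense_outside [Finite V] [Finite E] : Dense D.outside :=
  (dense_compl_iUnion_range (by rw [Complex.rank_real_complex]; exact Nat.one_lt_ofNat)
    (fun e => (D.arc e).continuous) D.arc_injective).sdiff_finite (Set.finite_range D.pt)

end Geometry

section Branch

/-- A continuous branch of `√((z - src e) (z - tgt e))` off the arc `e`. -/
noncomputable def branch (e : E) : ℂ → ℂ :=
  (exists_continuousOn_sqrt_compl_range (D.arc e)).choose

theorem continuousAt_branch {e : E} {z : ℂ} (hz : z ∉ Set.range (D.arc e)) :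
    ContinuousAt (D.branch e) z :=
  (exists_continuousOn_sqrt_compl_range (D.arc e)).choose_spec.1.continuousAt
    (D.compl_range_arc_mem_nhds hz)

theorem branch_sq {e : E} {z : ℂ} (hz : z ∉ Set.range (D.arc e)) :
    D.branch e z ^ 2 = (z - D.pt (D.src e)) * (z - D.pt (D.tgt e)) := by
  rw [← D.arc_zero, ← D.arc_one]
  exact (exists_continuousOn_sqrt_compl_range (D.arc e)).choose_spec.2 z hz

open Classical in
/-- The sign, as an element of `ZMod 2`, by which `branch e z` differs from the product of the
square roots `ρ` of `z - src e` and `z - tgt e`. On the arc `e` itself the value is arbitrary. -/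
noncomputable def sign (z : ℂ) (ρ : V → ℂ) (e : E) : ZMod 2 :=
  if D.branch e z = ρ (D.src e) * ρ (D.tgt e) then 0 else 1

variable {D} {z : ℂ} {ρ : V → ℂ}

theorem branch_sq_eq_sq_mul (hρ : ∀ v, ρ v ^ 2 = z - D.pt v) {e : E}
    (he : z ∉ Set.range (D.arc e)) :
    D.branch e z ^ 2 = (ρ (D.src e) * ρ (D.tgt e)) ^ 2 := by
  rw [D.branch_sq he, mul_pow, hρ, hρ]

theorem branch_eq_sign_mul (hρ : ∀ v, ρ v ^ 2 = z - D.pt v) {e : E}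
    (he : z ∉ Set.range (D.arc e)) :
    D.branch e z = χ (D.sign z ρ e) * (ρ (D.src e) * ρ (D.tgt e)) := by
  unfold sign
  split_ifs with h
  · rw [h, AddChar.map_zero_eq_one, one_mul]
  · rw [stdAddChar_two_one, neg_one_mul]
    exact (sq_eq_sq_iff_eq_or_eq_neg.1 (branch_sq_eq_sq_mul hρ he)).resolve_left h

theorem sign_eq_of_branch_eq {e : E} {x : ZMod 2} (h₀ : ρ (D.src e) * ρ (D.tgt e) ≠ 0)
    (h : D.branch e z = χ x * (ρ (D.src e) * ρ (D.tgt e))) : D.sign z ρ e = x := by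
  unfold sign
  rcases zmod_two_eq_zero_or_eq_one x with rfl | rfl
  · rw [if_pos (by rw [h, AddChar.map_zero_eq_one, one_mul])]
  · rw [if_neg]
    rw [h, stdAddChar_two_one, neg_one_mul]
    exact neg_ne_self.2 h₀

theorem root_ne_zero (hz : z ∉ Set.range D.pt) (hρ : ∀ v, ρ v ^ 2 = z - D.pt v) (v : V) :
    ρ v ≠ 0 := fun h => hz ⟨v, by
  rw [eq_comm, ← sub_eq_zero, ← hρ, h, zero_pow two_ne_zero]⟩

theorem eventually_sign_eq {z₀ : ℂ} (hz₀ : z₀ ∉ Set.range D.pt) {ρ : ℂ → V → ℂ}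
    (hρc : ContinuousAt ρ z₀) (hρ : ∀ z v, ρ z v ^ 2 = z - D.pt v) {e : E}
    (he : z₀ ∉ Set.range (D.arc e)) :
    ∀ᶠ z in 𝓝 z₀, D.sign z (ρ z) e = D.sign z₀ (ρ z₀) e := by
  have hroot (v : V) : ContinuousAt (fun z => ρ z v) z₀ := continuousAt_pi.1 hρc v
  have hprod := (hroot (D.src e)).mul (hroot (D.tgt e))
  have hne : ρ z₀ (D.src e) * ρ z₀ (D.tgt e) ≠ 0 :=
    mul_ne_zero (root_ne_zero hz₀ (hρ z₀) _) (root_ne_zero hz₀ (hρ z₀) _)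
  have hbranch : D.branch e =ᶠ[𝓝 z₀]
      fun z => χ (D.sign z₀ (ρ z₀) e) * (ρ z (D.src e) * ρ z (D.tgt e)) := by
    refine eventuallyEq_of_sq_eq (D.continuousAt_branch he) (continuousAt_const.mul hprod) ?_
      (branch_eq_sign_mul (hρ z₀) he) (mul_ne_zero (stdAddChar_two_ne_zero _) hne)
    filter_upwards [D.compl_range_arc_mem_nhds he] with z hz
    rw [branch_sq_eq_sq_mul (hρ z) hz, mul_pow (χ _), stdAddChar_two_sq, one_mul]
  filter_upwards [hbranch, hprod.eventually_ne hne] with z hz hz0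
  exact sign_eq_of_branch_eq hz0 hz

theorem exists_continuousAt_roots (D : ArcSystem V E) {z₀ : ℂ} (hz₀ : z₀ ∉ Set.range D.pt) :
    ∃ ρ : ℂ → V → ℂ, ContinuousAt ρ z₀ ∧ ∀ z v, ρ z v ^ 2 = z - D.pt v := by
  choose ρ hρc hρ using fun v => exists_sq_eq_of_ne_zero (f := fun z => z - D.pt v)
    (by fun_prop) (sub_ne_zero.2 fun h => hz₀ ⟨v, h.symm⟩)
  exact ⟨fun z v => ρ v z, continuousAt_pi.2 fun v => (hρc v).self_of_nhds, fun z v => hρ v z⟩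

end Branch

section Face

/-- The coboundary map of the underlying graph with coefficients modulo `2`. -/
def coboundary : (V → ZMod 2) →ₗ[ZMod 2] (E → ZMod 2) where
  toFun x e := x (D.src e) + x (D.tgt e)
  map_add' x y := by
    ext e
    simp only [Pi.add_apply]
    ring
  map_smul' c x := by
    ext e
    simp only [Pi.smul_apply, smul_eq_mul, RingHom.id_apply, mul_add]

theorem coboundary_apply (x : V → ZMod 2) (e : E) :
    D.coboundary x e = x (D.src e) + x (D.tgt e) := rfl

/-- The edge space modulo the cut space. The connected components of the complement of the drawing
are labelled by elements of this space. -/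
abbrev FaceSpace : Type _ := (E → ZMod 2) ⧸ LinearMap.range D.coboundary

/-- The label of a point of the plane: the class of the signs of all branches relative to square
roots chosen at the vertices. Modulo the cut space it does not depend on this choice. -/
noncomputable def face (z : ℂ) : D.FaceSpace :=
  Submodule.Quotient.mk (D.sign z fun v => (z - D.pt v) ^ (2⁻¹ : ℂ))

open Classical in
/-- The class of an edge in the face space, that is, the difference of the labels on its two
sides. -/
noncomputable def dual (e : E) : D.FaceSpace := Submodule.Quotient.mk (Pi.single e 1)

theorem mk_coboundary (x : V → ZMod 2) :
    (Submodule.Quotient.mk (D.coboundary x) : D.FaceSpace) = 0 :=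
  (Submodule.Quotient.mk_eq_zero _).2 ⟨x, rfl⟩

variable {D}

theorem mk_sub_mk_eq_smul_dual {e : E} {η η' : E → ZMod 2} (h : ∀ f ≠ e, η f = η' f) :
    (Submodule.Quotient.mk η - Submodule.Quotient.mk η' : D.FaceSpace) =
      (η e - η' e) • D.dual e := by
  rw [dual, ← Submodule.Quotient.mk_sub, ← Submodule.Quotient.mk_smul]
  congr 1
  ext f
  obtain rfl | hf := eq_or_ne f e
  · simp
  · simp [h f hf, hf]

theorem exists_sign_eq_add_coboundary {z : ℂ} (hz : z ∉ Set.range D.pt) {ρ ρ' : V → ℂ}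
    (hρ : ∀ v, ρ v ^ 2 = z - D.pt v) (hρ' : ∀ v, ρ' v ^ 2 = z - D.pt v) :
    ∃ x : V → ZMod 2, ∀ e, z ∉ Set.range (D.arc e) →
      D.sign z ρ' e = (D.sign z ρ + D.coboundary x) e := by
  choose x hx using fun v => exists_eq_stdAddChar_two_mul ((hρ v).trans (hρ' v).symm)
  refine ⟨x, fun e he => sign_eq_of_branch_eq
    (mul_ne_zero (root_ne_zero hz hρ' _) (root_ne_zero hz hρ' _)) ?_⟩
  rw [branch_eq_sign_mul hρ he, hx, hx (D.tgt e), Pi.add_apply, coboundary_apply,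
    AddChar.map_add_eq_mul, AddChar.map_add_eq_mul]
  ring

theorem face_eq_mk_sign {z : ℂ} (hz : z ∈ D.outside) {ρ : V → ℂ}
    (hρ : ∀ v, ρ v ^ 2 = z - D.pt v) : D.face z = Submodule.Quotient.mk (D.sign z ρ) := by
  obtain ⟨x, hx⟩ :=
    exists_sign_eq_add_coboundary hz.2 hρ fun v => Complex.cpow_ofNat_inv_pow (z - D.pt v) 2
  rw [face, funext fun e => hx e (D.notMem_range_arc_of_mem_outside hz e),
    Submodule.Quotient.mk_add, mk_coboundary, add_zero]

theorem face_sub_mk_sign_mem_span {z : ℂ} (hz : z ∉ Set.range D.pt) {ρ : V → ℂ}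
    (hρ : ∀ v, ρ v ^ 2 = z - D.pt v) {e : E} (he : ∀ f ≠ e, z ∉ Set.range (D.arc f)) :
    D.face z - Submodule.Quotient.mk (D.sign z ρ) ∈ Submodule.span (ZMod 2) {D.dual e} := by
  obtain ⟨x, hx⟩ := exists_sign_eq_add_coboundary hz hρ
    fun v => Complex.cpow_ofNat_inv_pow (z - D.pt v) 2
  have hdiff := mk_sub_mk_eq_smul_dual (D := D) fun f hf => hx f (he f hf)
  rw [Submodule.Quotient.mk_add, mk_coboundary, add_zero] at hdiff
  rw [face, hdiff]
  exact Submodule.smul_mem _ _ (Submodule.mem_span_singleton_self _)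

theorem eventually_face_sub_mem_span [Finite V] [Finite E] {z₀ : ℂ} (hz₀ : z₀ ∉ Set.range D.pt)
    {e : E} (he : ∀ f ≠ e, z₀ ∉ Set.range (D.arc f)) :
    ∀ᶠ z in 𝓝 z₀, D.face z - D.face z₀ ∈ Submodule.span (ZMod 2) {D.dual e} := by
  obtain ⟨ρ, hρc, hρ⟩ := D.exists_continuousAt_roots hz₀
  have hsign : ∀ᶠ z in 𝓝 z₀, ∀ f ≠ e,
      z ∉ Set.range (D.arc f) ∧ D.sign z (ρ z) f = D.sign z₀ (ρ z₀) f := by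
    simp only [eventually_all]
    exact fun f hf => Filter.Eventually.and (D.compl_range_arc_mem_nhds (he f hf))
      (eventually_sign_eq hz₀ hρc hρ (he f hf))
  filter_upwards [D.compl_range_pt_mem_nhds hz₀, hsign] with z hz hsignz
  have hmk : (Submodule.Quotient.mk (D.sign z (ρ z)) - Submodule.Quotient.mk (D.sign z₀ (ρ z₀)) :
      D.FaceSpace) ∈ Submodule.span (ZMod 2) {D.dual e} := by
    rw [mk_sub_mk_eq_smul_dual fun f hf => (hsignz f hf).2]
    exact Submodule.smul_mem _ _ (Submodule.mem_span_singleton_self _)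
  have hz_sub := face_sub_mk_sign_mem_span hz (hρ z) fun f hf => (hsignz f hf).1
  have hz₀_sub := face_sub_mk_sign_mem_span hz₀ (hρ z₀) he
  convert Submodule.sub_mem _ (Submodule.add_mem _ hz_sub hmk) hz₀_sub using 1
  abel

/-- The label of the midpoint of an edge, which is the label of one of its sides; which one depends
on the arbitrary sign of that edge at the midpoint. -/
noncomputable def sideFace (D : ArcSystem V E) (e : E) : D.FaceSpace :=
  D.face (D.arc e ⟨1 / 2, by norm_num, by norm_num⟩)

/-- The labels on the two sides of an edge; they agree if the edge is a bridge. -/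
def sides (D : ArcSystem V E) (e : E) : Set D.FaceSpace :=
  {D.sideFace e, D.sideFace e + D.dual e}

theorem mem_sides_iff {q : D.FaceSpace} {e : E} :
    q ∈ D.sides e ↔ q - D.sideFace e ∈ Submodule.span (ZMod 2) {D.dual e} := by
  rw [Submodule.mem_span_singleton]
  constructor
  · rintro (rfl | rfl)
    · exact ⟨0, by rw [zero_smul, sub_self]⟩
    · exact ⟨1, by rw [one_smul, add_sub_cancel_left]⟩
  · rintro ⟨y, hy⟩
    obtain rfl := eq_add_of_sub_eq' hy.symm
    rcases zmod_two_eq_zero_or_eq_one y with rfl | rfl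
    · exact .inl (by rw [zero_smul, add_zero])
    · exact .inr (congrArg _ (one_smul _ _))

theorem half_mem_Ioo :
    (⟨1 / 2, by norm_num, by norm_num⟩ : unitInterval) ∈ Set.Ioo (0 : unitInterval) 1 := by
  constructor <;> rw [← Subtype.coe_lt_coe] <;> norm_num

variable [Finite V] [Finite E]

theorem face_arc_mem_sides (e : E) {t : unitInterval} (ht : t ∈ Set.Ioo (0 : unitInterval) 1) :
    D.face (D.arc e t) ∈ D.sides e := by
  rw [mem_sides_iff]
  refine isPreconnected_Ioo.induction₂
    (fun s t => D.face (D.arc e t) - D.face (D.arc e s) ∈ Submodule.span (ZMod 2) {D.dual e})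
    (fun s hs => ?_) (fun _ _ _ _ _ _ h₁ h₂ => ?_) (fun _ _ _ _ h => ?_) half_mem_Ioo ht
  · have hnear := eventually_face_sub_mem_span (D.arc_notMem_range_pt e hs)
      fun f hf => D.arc_notMem_range_arc hf hs
    exact nhdsWithin_le_nhds ((D.arc e).continuous.continuousAt.eventually hnear)
  · simpa only [sub_add_sub_cancel] using Submodule.add_mem _ h₂ h₁
  · simpa only [neg_sub] using Submodule.neg_mem _ h

theorem eventually_face_mem_sides (e : E) {t : unitInterval}
    (ht : t ∈ Set.Ioo (0 : unitInterval) 1) : ∀ᶠ z in 𝓝 (D.arc e t), D.face z ∈ D.sides e := by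
  filter_upwards [eventually_face_sub_mem_span (D.arc_notMem_range_pt e ht)
    fun f hf => D.arc_notMem_range_arc hf ht] with z hz
  rw [mem_sides_iff]
  simpa only [sub_add_sub_cancel] using
    Submodule.add_mem _ hz (mem_sides_iff.1 (face_arc_mem_sides (D := D) e ht))

theorem exists_mem_outside_face_mem_sides (D : ArcSystem V E) (e : E) :
    ∃ z ∈ D.outside, D.face z ∈ D.sides e := by
  obtain ⟨z, hz, hzo⟩ := mem_closure_iff_nhds.1 (D.dense_outside _) _
    (eventually_face_mem_sides (D := D) e half_mem_Ioo)
  exact ⟨z, hzo, hz⟩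

end Face

section SignedBranch

variable {D}

/-- The jump of a function of the labels across an edge. -/
noncomputable def jump (φ : D.FaceSpace → ZMod 2) (e : E) : ZMod 2 :=
  φ (D.sideFace e) + φ (D.sideFace e + D.dual e)

theorem apply_add_dual {φ : D.FaceSpace → ZMod 2} {e : E} {q : D.FaceSpace} (hq : q ∈ D.sides e) :
    φ (q + D.dual e) = φ q + jump φ e := by
  rcases hq with rfl | rfl
  · rw [jump, CharTwo.add_cancel_left]
  · rw [jump, add_assoc (D.sideFace e), ZModModule.add_self, add_zero, add_left_comm,
      CharTwo.add_self_eq_zero, add_zero]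

variable [Fintype E]

open Classical in
/-- The edges across which a function of the labels jumps. -/
noncomputable def support (φ : D.FaceSpace → ZMod 2) : Finset E :=
  Finset.univ.filter fun e => jump φ e = 1

theorem mem_support {φ : D.FaceSpace → ZMod 2} {e : E} : e ∈ support φ ↔ jump φ e = 1 := by
  rw [support, Finset.mem_filter_univ]

/-- The product of the branches of the edges across which `φ` jumps, with the sign `φ` of the
label. Crossing an edge changes the sign of its branch and the value of `φ` together. -/
noncomputable def signedBranch (φ : D.FaceSpace → ZMod 2) (z : ℂ) : ℂ :=
  χ (φ (D.face z)) * ∏ e ∈ support φ, D.branch e z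

/-- The sign by which `signedBranch φ` differs from a product of square roots at the vertices, in
terms of the signs of the individual branches. -/
noncomputable def phase (φ : D.FaceSpace → ZMod 2) (η : E → ZMod 2) : ZMod 2 :=
  φ (Submodule.Quotient.mk η) + ∑ e ∈ support φ, η e

open Classical in
theorem phase_add_single {φ : D.FaceSpace → ZMod 2} {e : E} {η : E → ZMod 2}
    (hη : Submodule.Quotient.mk η ∈ D.sides e) : phase φ (η + Pi.single e 1) = phase φ η := by
  have hsum : ∑ f ∈ support φ, (Pi.single e 1 : E → ZMod 2) f = jump φ e := by
    rw [Finset.sum_pi_single']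
    rcases zmod_two_eq_zero_or_eq_one (jump φ e) with h | h <;> simp [mem_support, h]
  simp only [phase, Submodule.Quotient.mk_add, Pi.add_apply, Finset.sum_add_distrib]
  rw [← dual, apply_add_dual (φ := φ) hη, hsum, add_add_add_comm, CharTwo.add_self_eq_zero,
    add_zero]

theorem phase_congr {φ : D.FaceSpace → ZMod 2} {e : E} {η η' : E → ZMod 2}
    (hη : Submodule.Quotient.mk η ∈ D.sides e) (h : ∀ f ≠ e, η f = η' f) :
    phase φ η = phase φ η' := by
  classical
  have hsingle : η' = η + Pi.single e (η' e - η e) := by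
    ext f
    obtain rfl | hf := eq_or_ne f e
    · simp
    · simp [h f hf, hf]
  rcases zmod_two_eq_zero_or_eq_one (η' e - η e) with hy | hy
  · rw [hsingle, hy, Pi.single_zero, add_zero]
  · rw [hsingle, hy, phase_add_single hη]

theorem signedBranch_eq (φ : D.FaceSpace → ZMod 2) {z : ℂ} (hz : z ∈ D.outside) {ρ : V → ℂ}
    (hρ : ∀ v, ρ v ^ 2 = z - D.pt v) : signedBranch φ z =
      χ (phase φ (D.sign z ρ)) * ∏ e ∈ support φ, (ρ (D.src e) * ρ (D.tgt e)) := by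
  rw [signedBranch, phase, face_eq_mk_sign hz hρ, AddChar.map_add_eq_mul, addChar_sum_eq_prod,
    mul_assoc, ← Finset.prod_mul_distrib]
  exact congrArg _ <| Finset.prod_congr rfl fun e _ =>
    branch_eq_sign_mul hρ (D.notMem_range_arc_of_mem_outside hz e)

variable [Finite V]

theorem eventually_phase_sign_eq (φ : D.FaceSpace → ZMod 2) {z₀ : ℂ} (hz₀ : z₀ ∉ Set.range D.pt)
    {ρ : ℂ → V → ℂ} (hρc : ContinuousAt ρ z₀) (hρ : ∀ z v, ρ z v ^ 2 = z - D.pt v) :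
    ∀ᶠ z in 𝓝[D.outside] z₀, phase φ (D.sign z (ρ z)) = phase φ (D.sign z₀ (ρ z₀)) := by
  have hsign : ∀ᶠ z in 𝓝[D.outside] z₀, ∀ f, z₀ ∉ Set.range (D.arc f) →
      D.sign z (ρ z) f = D.sign z₀ (ρ z₀) f := by
    simp only [eventually_all]
    exact fun f hf => nhdsWithin_le_nhds (eventually_sign_eq hz₀ hρc hρ hf)
  by_cases harc : ∃ e, z₀ ∈ Set.range (D.arc e)
  · obtain ⟨e, t, rfl⟩ := harc
    have ht := D.mem_Ioo_of_arc_notMem_range_pt hz₀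
    filter_upwards [hsign, nhdsWithin_le_nhds (eventually_face_mem_sides e ht),
      self_mem_nhdsWithin] with z hsignz hface hz
    rw [face_eq_mk_sign hz (hρ z)] at hface
    exact phase_congr hface fun f hf => hsignz f (D.arc_notMem_range_arc hf ht)
  · filter_upwards [hsign] with z hsignz
    rw [funext fun f => hsignz f fun hf => harc ⟨f, hf⟩]

theorem exists_tendsto_signedBranch (φ : D.FaceSpace → ZMod 2) {z₀ : ℂ}
    (hz₀ : z₀ ∉ Set.range D.pt) :
    ∃ y, Tendsto (signedBranch φ) (𝓝[D.outside] z₀) (𝓝 y) ∧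
      y ^ 2 = ∏ e ∈ support φ, ((z₀ - D.pt (D.src e)) * (z₀ - D.pt (D.tgt e))) := by
  obtain ⟨ρ, hρc, hρ⟩ := D.exists_continuousAt_roots hz₀
  have hroot (v : V) : Tendsto (fun z => ρ z v) (𝓝[D.outside] z₀) (𝓝 (ρ z₀ v)) :=
    (continuousAt_pi.1 hρc v).mono_left nhdsWithin_le_nhds
  refine ⟨χ (phase φ (D.sign z₀ (ρ z₀))) * ∏ e ∈ support φ, (ρ z₀ (D.src e) * ρ z₀ (D.tgt e)),
    ?_, ?_⟩
  · refine (tendsto_const_nhds.mul <| tendsto_finsetProd _ fun e _ =>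
      (hroot (D.src e)).mul (hroot (D.tgt e))).congr' ?_
    filter_upwards [eventually_phase_sign_eq φ hz₀ hρc hρ, self_mem_nhdsWithin] with z hphase hz
    rw [signedBranch_eq φ hz (hρ z), hphase]
  · rw [mul_pow, stdAddChar_two_sq, one_mul, ← Finset.prod_pow]
    exact Finset.prod_congr rfl fun e _ => by rw [mul_pow, hρ, hρ]

/-- The continuous extension of the signed product of branches to the complement of the vertices:
a branch of `√∏ (z - src e) (z - tgt e)` over the edges across which `φ` jumps. -/
noncomputable def extendedBranch (φ : D.FaceSpace → ZMod 2) : ℂ → ℂ :=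
  extendFrom D.outside (signedBranch φ)

theorem continuousOn_extendedBranch (φ : D.FaceSpace → ZMod 2) :
    ContinuousOn (extendedBranch φ) (Set.range D.pt)ᶜ :=
  continuousOn_extendFrom (fun z _ => D.dense_outside z) fun _ hz =>
    (exists_tendsto_signedBranch φ hz).imp fun _ => And.left

theorem extendedBranch_sq (φ : D.FaceSpace → ZMod 2) {z : ℂ} (hz : z ∉ Set.range D.pt) :
    extendedBranch φ z ^ 2 =
      ∏ e ∈ support φ, ((z - D.pt (D.src e)) * (z - D.pt (D.tgt e))) := by
  obtain ⟨y, hlim, hy⟩ := exists_tendsto_signedBranch φ hz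
  rw [extendedBranch, extendFrom_eq (D.dense_outside z) hlim, hy]

theorem extendedBranch_eq_signedBranch (φ : D.FaceSpace → ZMod 2) {z : ℂ} (hz : z ∈ D.outside) :
    extendedBranch φ z = signedBranch φ z := by
  obtain ⟨y, hlim, -⟩ := exists_tendsto_signedBranch φ hz.2
  rw [extendedBranch, extendFrom_eq (D.dense_outside z) hlim]
  exact tendsto_nhds_unique (hlim.mono_left (pure_le_nhdsWithin hz)) (tendsto_pure_nhds _ z)

theorem even_card_support_filter [DecidableEq V] (φ : D.FaceSpace → ZMod 2) (v : V) :
    Even ((support φ).filter fun e => D.src e = v ∨ D.tgt e = v).card := by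
  let rest (u : V) (z : ℂ) : ℂ := if u = v then 1 else z - D.pt u
  have hrest (u : V) : Continuous (rest u) := by
    by_cases hu : u = v
    · simpa only [rest, if_pos hu] using continuous_const
    · simpa only [rest, if_neg hu] using continuous_sub_right _
  have hrest_ne (u : V) : rest u (D.pt v) ≠ 0 := by
    by_cases hu : u = v
    · simp only [rest, if_pos hu, ne_eq, one_ne_zero, not_false_eq_true]
    · simpa only [rest, if_neg hu, sub_ne_zero] using fun h => hu (D.pt_injective h).symm
  have hfactor (e : E) (z : ℂ) : (z - D.pt (D.src e)) * (z - D.pt (D.tgt e)) =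
      (if D.src e = v ∨ D.tgt e = v then z - D.pt v else 1) *
        (rest (D.src e) z * rest (D.tgt e) z) := by
    have hne := D.src_ne_tgt e
    grind
  have hnear : ∀ᶠ z in 𝓝[≠] D.pt v, z ∉ Set.range D.pt := by
    have hfin : (Set.range D.pt \ {D.pt v}).Finite := (Set.finite_range D.pt).sdiff
    filter_upwards [self_mem_nhdsWithin, nhdsWithin_le_nhds <|
      hfin.isClosed.isOpen_compl.mem_nhds fun h => h.2 rfl] with z hz hz' h
    exact hz' ⟨h, hz⟩
  refine even_of_eventually_sq_eq (s := extendedBranch φ) (v := D.pt v)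
    (h := fun z => ∏ e ∈ support φ, (rest (D.src e) z * rest (D.tgt e) z)) ?_ (by fun_prop)
    (Finset.prod_ne_zero_iff.2 fun e _ => mul_ne_zero (hrest_ne _) (hrest_ne _)) ?_
  · exact hnear.mono fun z hz =>
      (continuousOn_extendedBranch φ).continuousAt (D.compl_range_pt_mem_nhds hz)
  · filter_upwards [hnear] with z hz
    rw [extendedBranch_sq φ hz, Finset.prod_congr rfl fun e _ => hfactor e z,
      Finset.prod_mul_distrib, ← Finset.prod_filter, Finset.prod_const]

theorem apply_face_eq_of_support_eq_empty {φ : D.FaceSpace → ZMod 2} (hφ : support φ = ∅) {z w : ℂ}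
    (hz : z ∈ D.outside) (hw : w ∈ D.outside) : φ (D.face z) = φ (D.face w) := by
  have hconn : IsPreconnected (Set.range D.pt)ᶜ :=
    ((Set.finite_range D.pt).countable.isConnected_compl_of_one_lt_rank
      (by rw [Complex.rank_real_complex]; exact Nat.one_lt_ofNat)).isPreconnected
  have hsq {x : ℂ} (hx : x ∉ Set.range D.pt) : extendedBranch φ x ^ 2 = 1 := by
    rw [extendedBranch_sq φ hx, hφ, Finset.prod_empty]
  have hsign {x : ℂ} (hx : x ∈ D.outside) : extendedBranch φ x = χ (φ (D.face x)) := by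
    rw [extendedBranch_eq_signedBranch φ hx, signedBranch, hφ, Finset.prod_empty, mul_one]
  apply ZMod.injective_stdAddChar
  rw [← hsign hz, ← hsign hw]
  refine hconn.eq_of_sq_eq (continuousOn_extendedBranch φ) continuousOn_const
    (fun x hx => (hsq hx).trans (hsq hw.2).symm) (fun _ h => ?_) hw.2 rfl hz.2
  simpa [h] using hsq hw.2

end SignedBranch

section Boundary

variable {D} [Fintype E]

theorem mem_support_indicator_one {A : Set D.FaceSpace} {e : E} :
    e ∈ support (A.indicator 1) ↔ ¬(D.sideFace e ∈ A ↔ D.sideFace e + D.dual e ∈ A) := by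
  have htwo : (1 : ZMod 2) + 1 ≠ 1 := by decide
  rw [mem_support, jump]
  by_cases h₁ : D.sideFace e ∈ A <;> by_cases h₂ : D.sideFace e + D.dual e ∈ A <;>
    simp [h₁, h₂, htwo]

/-- The boundary of the face with label `q`: the edges that have `q` on exactly one side. -/
noncomputable def boundary (q : D.FaceSpace) : Finset E :=
  support (({q} : Set D.FaceSpace).indicator 1)

theorem mem_boundary {q : D.FaceSpace} {e : E} :
    e ∈ boundary q ↔ D.dual e ≠ 0 ∧ q ∈ D.sides e := by
  have hdual : D.dual e = 0 ↔ D.sideFace e + D.dual e = D.sideFace e := add_eq_left.symm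
  rw [boundary, mem_support_indicator_one, ne_eq, hdual, sides, Set.mem_insert_iff]
  simp only [Set.mem_singleton_iff]
  grind

theorem mem_boundary_iff_of_mem {q q' : D.FaceSpace} {e : E} (he : e ∈ boundary q) :
    e ∈ boundary q' ↔ q' = q ∨ q' = q + D.dual e := by
  rw [mem_boundary] at he ⊢
  rw [and_iff_right he.1]
  rcases he.2 with rfl | rfl
  · exact Iff.rfl
  · rw [add_assoc, ZModModule.add_self, add_zero, or_comm]
    exact Iff.rfl

theorem eq_of_mem_boundary_of_ne {p q k : D.FaceSpace} {e : E} (hpq : p ≠ q)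
    (hp : e ∈ boundary p) (hq : e ∈ boundary q) (hk : e ∈ boundary k) : k = p ∨ k = q := by
  obtain rfl := ((mem_boundary_iff_of_mem hp).1 hq).resolve_left hpq.symm
  exact (mem_boundary_iff_of_mem hp).1 hk

theorem even_card_boundary_filter [Finite V] [DecidableEq V] (q : D.FaceSpace) (v : V) :
    Even ((boundary q).filter fun e => D.src e = v ∨ D.tgt e = v).card :=
  even_card_support_filter _ v

theorem support_indicator_pair_eq_empty {p q : D.FaceSpace} (hpq : p ≠ q)
    (h : boundary p = boundary q) : support (({p, q} : Set D.FaceSpace).indicator 1) = ∅ := by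
  refine Finset.eq_empty_of_forall_notMem fun e he => ?_
  have hiff := Finset.ext_iff.1 h e
  rw [boundary, boundary, mem_support_indicator_one, mem_support_indicator_one] at hiff
  rw [mem_support_indicator_one] at he
  simp only [Set.mem_insert_iff, Set.mem_singleton_iff] at he hiff
  grind

theorem eq_or_eq_of_boundary_eq [Finite V] {p q k : D.FaceSpace} (hpq : p ≠ q)
    (h : boundary p = boundary q) (hp : (boundary p).Nonempty) (hk : (boundary k).Nonempty) :
    k = p ∨ k = q := by
  obtain ⟨e₀, he₀⟩ := hp
  obtain ⟨e, he⟩ := hk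
  obtain ⟨z₀, hz₀, hface₀⟩ := D.exists_mem_outside_face_mem_sides e₀
  obtain ⟨z, hz, hface⟩ := D.exists_mem_outside_face_mem_sides e
  have he₀z₀ : e₀ ∈ boundary (D.face z₀) := mem_boundary.2 ⟨(mem_boundary.1 he₀).1, hface₀⟩
  have hez : e ∈ boundary (D.face z) := mem_boundary.2 ⟨(mem_boundary.1 he).1, hface⟩
  have hz₀_mem : D.face z₀ ∈ ({p, q} : Set D.FaceSpace) :=
    eq_of_mem_boundary_of_ne hpq he₀ (h ▸ he₀) he₀z₀
  have hz_mem : D.face z ∈ ({p, q} : Set D.FaceSpace) := by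
    by_contra hz_notMem
    simpa [hz₀_mem, hz_notMem] using
      apply_face_eq_of_support_eq_empty (support_indicator_pair_eq_empty hpq h) hz₀ hz
  have hep : e ∈ boundary p := hz_mem.elim (fun hzp => hzp ▸ hez) fun hzq => h ▸ hzq ▸ hez
  exact eq_of_mem_boundary_of_ne hpq hep (h ▸ hep) he

end Boundary

section Euler

theorem span_range_dual [Finite E] : Submodule.span (ZMod 2) (Set.range D.dual) = ⊤ := by
  classical
  have hrange : Set.range D.dual =
      (LinearMap.range D.coboundary).mkQ '' Set.range (Pi.basisFun (ZMod 2) E) := by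
    rw [← Set.range_comp]
    exact congrArg Set.range <| funext fun e => by rw [Function.comp_apply, Pi.basisFun_apply]; rfl
  rw [hrange, Submodule.span_image, Module.Basis.span_eq, Submodule.map_top, Submodule.range_mkQ]

theorem card_add_one_le_finrank_add_card [Fintype V] [Fintype E] [Nonempty V] :
    Fintype.card E + 1 ≤ Module.finrank (ZMod 2) D.FaceSpace + Fintype.card V := by
  have hquot := Submodule.finrank_quotient_add_finrank (LinearMap.range D.coboundary)
  have hrank := LinearMap.finrank_range_add_finrank_ker D.coboundary
  have hker : 0 < Module.finrank (ZMod 2) (LinearMap.ker D.coboundary) := by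
    rw [Module.finrank_pos_iff_exists_ne_zero]
    refine ⟨⟨1, ?_⟩, fun h => one_ne_zero (congrArg Subtype.val h)⟩
    exact funext fun _ => CharTwo.add_self_eq_zero 1
  rw [Module.finrank_fintype_fun_eq_card] at hquot hrank
  lia

variable [Fintype E]

/-- The faces with nonempty boundary. -/
abbrev Face : Type _ := {q : D.FaceSpace // (boundary q).Nonempty}

noncomputable instance : Fintype D.Face :=
  have : Finite D.FaceSpace := Finite.of_surjective _ (Submodule.mkQ_surjective _)
  Fintype.ofFinite D.Face

variable {D}

theorem exists_face_sub_eq_dual {e : E} (he : D.dual e ≠ 0) :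
    ∃ p q : D.Face, (p : D.FaceSpace) - q = D.dual e := by
  refine ⟨⟨D.sideFace e + D.dual e, e, mem_boundary.2 ⟨he, .inr rfl⟩⟩,
    ⟨D.sideFace e, e, mem_boundary.2 ⟨he, .inl rfl⟩⟩, add_sub_cancel_left _ _⟩

theorem dual_mem_vectorSpan (e : E) :
    D.dual e ∈ vectorSpan (ZMod 2) (Set.range (Subtype.val : D.Face → D.FaceSpace)) := by
  by_cases he : D.dual e = 0
  · exact he ▸ Submodule.zero_mem _
  · obtain ⟨p, q, hpq⟩ := exists_face_sub_eq_dual he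
    exact hpq ▸ vsub_mem_vectorSpan (ZMod 2) ⟨p, rfl⟩ ⟨q, rfl⟩

theorem vectorSpan_range_face :
    vectorSpan (ZMod 2) (Set.range (Subtype.val : D.Face → D.FaceSpace)) = ⊤ := by
  rw [eq_top_iff, ← D.span_range_dual, Submodule.span_le]
  exact Set.range_subset_iff.2 dual_mem_vectorSpan

variable (D)

theorem card_add_two_le_card_face_add_card [Fintype V] [Nonempty V] [Nonempty D.Face] :
    Fintype.card E + 2 ≤ Fintype.card D.Face + Fintype.card V := by
  have hrank := finrank_vectorSpan_range_le (ZMod 2) (Subtype.val : D.Face → D.FaceSpace)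
    (Nat.sub_add_cancel Fintype.card_pos).symm
  rw [vectorSpan_range_face, finrank_top] at hrank
  have := D.card_add_one_le_finrank_add_card
  have : 0 < Fintype.card D.Face := Fintype.card_pos
  lia

theorem card_add_one_le_card_of_isEmpty_face [Fintype V] [Nonempty V] [IsEmpty D.Face] :
    Fintype.card E + 1 ≤ Fintype.card V := by
  have hrank : Module.finrank (ZMod 2) D.FaceSpace = 0 := by
    rw [← finrank_top, ← vectorSpan_range_face, Set.range_eq_empty, vectorSpan_empty, finrank_bot]
  simpa only [hrank, zero_add] using D.card_add_one_le_finrank_add_card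

end Euler

section EdgeBound

variable {D} [Fintype E]

theorem card_face_le_two [Finite V] {p q : D.Face} (hpq : p ≠ q)
    (h : boundary (p : D.FaceSpace) = boundary (q : D.FaceSpace)) : Fintype.card D.Face ≤ 2 := by
  classical
  have huniv : (Finset.univ : Finset D.Face) ⊆ {p, q} := fun k _ => by
    simpa [Subtype.ext_iff] using
      eq_or_eq_of_boundary_eq (fun hval => hpq (Subtype.ext hval)) h p.2 k.2
  exact (Finset.card_le_card huniv).trans Finset.card_le_two

theorem card_le_two_mul_card_sub_two [Fintype V] (hcard : 4 ≤ Fintype.card V)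
    (hthree : ∀ p : D.Face, 3 ≤ (boundary (p : D.FaceSpace)).card)
    (htriangle : ∀ (p q : D.Face) (e : E),
      boundary (p : D.FaceSpace) ≠ boundary (q : D.FaceSpace) → e ∈ boundary (p : D.FaceSpace) →
      e ∈ boundary (q : D.FaceSpace) → (boundary (p : D.FaceSpace)).card = 3 →
      6 ≤ (boundary (q : D.FaceSpace)).card) :
    Fintype.card E ≤ 2 * (Fintype.card V - 2) := by
  classical
  have : Nonempty V := Fintype.card_pos_iff.1 (by lia)
  rcases isEmpty_or_nonempty D.Face with _ | _
  · have := D.card_add_one_le_card_of_isEmpty_face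
    lia
  have heuler := D.card_add_two_le_card_face_add_card
  by_cases hinj : Function.Injective fun p : D.Face => boundary (p : D.FaceSpace)
  · have := two_mul_card_faces_le_card_edges hthree
      (fun p q k e hpq hp hq hk => by
        simpa only [Subtype.ext_iff] using
          eq_of_mem_boundary_of_ne (fun h => hpq (Subtype.ext h)) hp hq hk)
      (fun p q e hpq => htriangle p q e (hinj.ne hpq))
    lia
  · obtain ⟨p, q, h, hpq⟩ := Function.not_injective_iff.1 hinj
    have := card_face_le_two hpq h
    lia

end EdgeBound

end ArcSystem

section EvenEdgeSets

open scoped symmDiff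

theorem card_symmDiff_add_two_mul_card_inter {α : Type*} [DecidableEq α] (s t : Finset α) :
    (s ∆ t).card + 2 * (s ∩ t).card = s.card + t.card := by
  have hst := Finset.card_sdiff_add_card_inter s t
  have hts := Finset.card_sdiff_add_card_inter t s
  rw [Finset.inter_comm] at hts
  rw [Finset.symmDiff_def, Finset.card_union_of_disjoint disjoint_sdiff_sdiff]
  lia

variable {V : Type*} {G : SimpleGraph V}

theorem not_isAcyclic_of_forall_exists_adj_ne [Finite G.edgeSet] (hG : G ≠ ⊥)
    (h : ∀ u v, G.Adj u v → ∃ w, w ≠ v ∧ G.Adj u w) : ¬ G.IsAcyclic := by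
  intro hacyc
  obtain ⟨a, b, hab⟩ := SimpleGraph.ne_bot_iff_exists_adj.1 hG
  have : Nonempty V := ⟨a⟩
  obtain ⟨u, v, p, hp, hmax⟩ := SimpleGraph.Walk.exists_isPath_forall_isPath_length_le_length G
  have hnil : ¬ p.Nil := SimpleGraph.Walk.not_nil_iff_lt_length.2 <|
    Nat.one_pos.trans_le <| hmax a b hab.toWalk hab.isPath_toWalk
  obtain ⟨w, hw, huw⟩ := h u p.snd (p.adj_snd hnil)
  have hwp : w ∉ p.support := fun hmem => hw (hacyc.eq_snd_of_adj_start hp huw hmem)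
  exact (Nat.lt_succ_self p.length).not_ge <| hmax w v (p.cons huw.symm) (hp.cons hwp)

variable [DecidableEq V]

/-- An element of the cycle space of `G` over `ZMod 2`, encoded as a set of edges: every vertex
lies on an even number of them. -/
def IsEvenEdgeSet (G : SimpleGraph V) (T : Finset (Sym2 V)) : Prop :=
  (T : Set (Sym2 V)) ⊆ G.edgeSet ∧ ∀ v, Even (T.filter (v ∈ ·)).card

theorem isEvenEdgeSet_edges_toFinset {u : V} {c : G.Walk u u} (hc : c.IsTrail) :
    IsEvenEdgeSet G c.edges.toFinset := by
  refine ⟨fun e he => c.edges_subset_edgeSet (by simpa using he), fun v => ?_⟩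
  have hfilter : c.edges.toFinset.filter (v ∈ ·) = (c.edges.filter (v ∈ ·)).toFinset := by
    ext e
    simp
  rw [hfilter, List.toFinset_card_of_nodup (hc.edges_nodup.filter _),
    ← List.countP_eq_length_filter, hc.even_countP_edges_iff]
  exact fun h => (h rfl).elim

theorem card_edges_toFinset {u v : V} {p : G.Walk u v} (hp : p.IsTrail) :
    p.edges.toFinset.card = p.length := by
  rw [List.toFinset_card_of_nodup hp.edges_nodup, p.length_edges]

namespace IsEvenEdgeSet

variable {T U : Finset (Sym2 V)}

theorem symmDiff (hT : IsEvenEdgeSet G T) (hU : IsEvenEdgeSet G U) :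
    IsEvenEdgeSet G (T ∆ U) := by
  refine ⟨?_, fun v => ?_⟩
  · rw [Finset.coe_symmDiff]
    exact Set.symmDiff_subset_union.trans (Set.union_subset hT.1 hU.1)
  · have hfilter : (T ∆ U).filter (v ∈ ·) = T.filter (v ∈ ·) ∆ U.filter (v ∈ ·) := by
      ext e
      simp only [Finset.mem_filter, Finset.mem_symmDiff]
      tauto
    have hcard := card_symmDiff_add_two_mul_card_inter (T.filter (v ∈ ·)) (U.filter (v ∈ ·))
    rw [hfilter]
    have := hT.2 v
    have := hU.2 v
    grind

theorem exists_ne_mem (hT : IsEvenEdgeSet G T) {u v : V} (h : s(u, v) ∈ T) :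
    ∃ w, w ≠ v ∧ s(u, w) ∈ T := by
  have hmem : s(u, v) ∈ T.filter (u ∈ ·) := by simp [h]
  have hlt : 1 < (T.filter (u ∈ ·)).card := by
    have := hT.2 u
    have := Finset.card_pos.2 ⟨_, hmem⟩
    grind
  obtain ⟨e, he, hne⟩ := Finset.exists_mem_ne hlt s(u, v)
  obtain ⟨heT, hue⟩ := Finset.mem_filter.1 he
  obtain ⟨w, rfl⟩ := Sym2.mem_iff_exists.1 hue
  exact ⟨w, fun h => hne (h ▸ rfl), heT⟩

theorem exists_isCycle_edges_subset (hT : IsEvenEdgeSet G T) (hne : T.Nonempty) :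
    ∃ (u : V) (c : G.Walk u u), c.IsCycle ∧ c.edges ⊆ T.toList := by
  let H := SimpleGraph.fromEdgeSet (T : Set (Sym2 V))
  have hle : H ≤ G := by
    simpa [H] using SimpleGraph.fromEdgeSet_mono hT.1
  have hedge : H.edgeSet = T := by
    simp only [H, SimpleGraph.edgeSet_fromEdgeSet]
    exact sdiff_eq_left.2 (Set.disjoint_left.2 fun e he => G.not_isDiag_of_mem_edgeSet (hT.1 he))
  have : Finite H.edgeSet := hedge ▸ T.finite_toSet
  have hbot : H ≠ ⊥ := by
    rw [← SimpleGraph.edgeSet_nonempty, hedge]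
    exact hne
  have hadj : ∀ u v, H.Adj u v ↔ s(u, v) ∈ T := fun u v => by
    rw [← SimpleGraph.mem_edgeSet, hedge, Finset.mem_coe]
  have hcyc : ¬ H.IsAcyclic := not_isAcyclic_of_forall_exists_adj_ne hbot fun u v => by
    simpa only [hadj] using hT.exists_ne_mem
  simp only [SimpleGraph.IsAcyclic, not_forall, not_not] at hcyc
  obtain ⟨u, c, hc⟩ := hcyc
  refine ⟨u, c.mapLe hle, hc.mapLe hle, fun e he => ?_⟩
  rw [SimpleGraph.Walk.edges_mapLe_eq_edges] at he
  simpa [hedge] using c.edges_subset_edgeSet he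

theorem three_le_card (hT : IsEvenEdgeSet G T) (hne : T.Nonempty) : 3 ≤ T.card := by
  obtain ⟨u, c, hc, hcT⟩ := hT.exists_isCycle_edges_subset hne
  rw [← Finset.length_toList]
  calc 3 ≤ c.edges.length := by simpa using hc.three_le_length
    _ ≤ T.toList.length := (hc.edges_nodup.subperm hcT).length_le

theorem exists_isCycle_edges_toFinset_eq (hT : IsEvenEdgeSet G T) (hne : T.Nonempty)
    (hcard : T.card ≤ 5) : ∃ (u : V) (c : G.Walk u u), c.IsCycle ∧ c.edges.toFinset = T := by
  obtain ⟨u, c, hc, hcT⟩ := hT.exists_isCycle_edges_subset hne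
  refine ⟨u, c, hc, ?_⟩
  have hsub : c.edges.toFinset ⊆ T := fun e he => by simpa using hcT (List.mem_toFinset.1 he)
  have hrest := (isEvenEdgeSet_edges_toFinset hc.isTrail).symmDiff hT
  by_contra hdiff
  have hthree := hrest.three_le_card (Finset.symmDiff_nonempty.2 hdiff)
  have hsum := card_symmDiff_add_two_mul_card_inter c.edges.toFinset T
  have hlen := hc.three_le_length
  rw [Finset.inter_eq_left.2 hsub, card_edges_toFinset hc.isTrail] at hsum
  lia

theorem hasTriangleAdjacentToCycle (hT : IsEvenEdgeSet G T) (hU : IsEvenEdgeSet G U)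
    (hTU : T ≠ U) {e : Sym2 V} (heT : e ∈ T) (heU : e ∈ U) (hTcard : T.card = 3)
    (hUcard : U.card ≤ 5) : G.HasTriangleAdjacentToCycle U.card := by
  obtain ⟨u, c, hc, rfl⟩ := hT.exists_isCycle_edges_toFinset_eq ⟨e, heT⟩ (by lia)
  obtain ⟨v, d, hd, rfl⟩ := hU.exists_isCycle_edges_toFinset_eq ⟨e, heU⟩ hUcard
  rw [card_edges_toFinset hc.isTrail] at hTcard
  refine ⟨u, v, c, d, hTcard, (card_edges_toFinset hd.isTrail).symm, hc, hd, fun hcd => hTU ?_,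
    e, List.mem_toFinset.1 heT, List.mem_toFinset.1 heU⟩
  ext f
  rw [List.mem_toFinset, List.mem_toFinset, ← c.mem_edges_toSubgraph, hcd, d.mem_edges_toSubgraph]

theorem six_le_card (h3 : ¬ G.HasTriangleAdjacentToCycle 3)
    (h5 : ¬ G.HasTriangleAdjacentToCycle 5) (hT : IsEvenEdgeSet G T) (hU : IsEvenEdgeSet G U)
    (hTU : T ≠ U) {e : Sym2 V} (heT : e ∈ T) (heU : e ∈ U) (hTcard : T.card = 3) :
    6 ≤ U.card := by
  have card_ne : ∀ {W : Finset (Sym2 V)} {f : Sym2 V}, IsEvenEdgeSet G W → T ≠ W → f ∈ T →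
      f ∈ W → W.card ≠ 3 ∧ W.card ≠ 5 := fun hW hTW hfT hfW =>
    ⟨fun h => h3 (h ▸ hT.hasTriangleAdjacentToCycle hW hTW hfT hfW hTcard (by lia)),
      fun h => h5 (h ▸ hT.hasTriangleAdjacentToCycle hW hTW hfT hfW hTcard (by lia))⟩
  obtain ⟨hU3, hU5⟩ := card_ne hU hTU heT heU
  have hUthree := hU.three_le_card ⟨e, heU⟩
  by_contra hlt
  have hU4 : U.card = 4 := by lia
  -- A quadrilateral through an edge of a triangle yields a triangle or a pentagon.
  have hTU_even := hT.symmDiff hU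
  have hsum := card_symmDiff_add_two_mul_card_inter T U
  have hthree := hTU_even.three_le_card (Finset.symmDiff_nonempty.2 hTU)
  have hpos : 0 < (T ∩ U).card := Finset.card_pos.2 ⟨e, Finset.mem_inter.2 ⟨heT, heU⟩⟩
  obtain ⟨f, hfT, hfU⟩ : ∃ f ∈ T, f ∉ U := by
    by_contra! hsub
    rw [Finset.inter_eq_left.2 hsub] at hsum
    lia
  have hne : T ≠ T ∆ U := fun h => by
    have := symmDiff_eq_left.1 h.symm
    simp [this] at heU
  obtain ⟨h3', h5'⟩ := card_ne hTU_even hne hfT (Finset.mem_symmDiff.2 (.inl ⟨hfT, hfU⟩))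
  lia

end IsEvenEdgeSet

end EvenEdgeSets

section PlaneDrawings

variable {V : Type*} {G : SimpleGraph V}

theorem exists_arc_ends_eq (P : G.PlaneDrawing) (e : G.edgeSet) :
    ∃ u v, (e : Sym2 V) = s(u, v) ∧ P.arc e 0 = P.point u ∧ P.arc e 1 = P.point v := by
  obtain ⟨e, he⟩ := e
  induction e using Sym2.ind with
  | _ a b =>
  have hends := P.arc_ends ⟨s(a, b), he⟩
  rw [Sym2.map_mk, Sym2.eq_iff] at hends
  rcases hends with ⟨h0, h1⟩ | ⟨h0, h1⟩
  · exact ⟨a, b, rfl, h0, h1⟩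
  · exact ⟨b, a, Sym2.eq_swap, h0, h1⟩

namespace ArcSystem

/-- The arcs of a drawing of a simple graph, carried over to `ℂ` and directed by their
parametrizations. -/
noncomputable def ofPlaneDrawing (P : G.PlaneDrawing) : ArcSystem V G.edgeSet :=
  let L := Complex.orthonormalBasisOneI.repr.symm
  { pt := L ∘ P.point
    arc := fun e => ⟨L ∘ P.arc e, L.continuous.comp (P.arc_continuous e)⟩
    src := fun e => (exists_arc_ends_eq P e).choose
    tgt := fun e => (exists_arc_ends_eq P e).choose_spec.choose
    pt_injective := L.injective.comp P.point_injective
    arc_injective := fun e => L.injective.comp (P.arc_injective e)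
    arc_zero := fun e => congrArg L (exists_arc_ends_eq P e).choose_spec.choose_spec.2.1
    arc_one := fun e => congrArg L (exists_arc_ends_eq P e).choose_spec.choose_spec.2.2
    arc_ne_pt := fun e t ht v h => P.arc_ne_point e t ht v (L.injective h)
    arc_ne_arc := fun e f hef s hs t ht h => P.arc_ne_arc e f hef s hs t ht (L.injective h) }

theorem coe_eq_mk_src_tgt (P : G.PlaneDrawing) (e : G.edgeSet) :
    (e : Sym2 V) = s((ofPlaneDrawing P).src e, (ofPlaneDrawing P).tgt e) :=
  (exists_arc_ends_eq P e).choose_spec.choose_spec.1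

theorem isEvenEdgeSet_map_boundary [Finite V] [Fintype G.edgeSet] [DecidableEq V]
    (P : G.PlaneDrawing) (q : (ofPlaneDrawing P).FaceSpace) :
    IsEvenEdgeSet G ((boundary q).map (.subtype _)) := by
  refine ⟨fun e he => ?_, fun v => ?_⟩
  · obtain ⟨e', -, rfl⟩ := Finset.mem_map.1 he
    exact e'.2
  · have hmem : ∀ e : G.edgeSet, v ∈ (e : Sym2 V) ↔
        (ofPlaneDrawing P).src e = v ∨ (ofPlaneDrawing P).tgt e = v := fun e => by
      rw [coe_eq_mk_src_tgt P e, Sym2.mem_iff, eq_comm, eq_comm (a := v)]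
    have heven := even_card_boundary_filter q v
    simp only [← hmem] at heven
    rwa [Finset.filter_map, Finset.card_map]

end ArcSystem

end PlaneDrawings

theorem mainTheorem6 {V : Type*} [Fintype V] (G : SimpleGraph V) [Fintype G.edgeSet]
    (hplanar : G.IsPlanar)
    (h3 : ¬ G.HasTriangleAdjacentToCycle 3)
    (h5 : ¬ G.HasTriangleAdjacentToCycle 5)
    (hn : 4 ≤ Fintype.card V) :
    G.edgeFinset.card ≤ 2 * (Fintype.card V - 2) := by
  classical
  obtain ⟨P⟩ := hplanar
  have heven := ArcSystem.isEvenEdgeSet_map_boundary P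
  rw [SimpleGraph.edgeFinset_card]
  refine (ArcSystem.ofPlaneDrawing P).card_le_two_mul_card_sub_two hn (fun p => ?_)
    fun p q e hpq hp hq hcard => ?_
  · simpa using (heven p).three_le_card p.2.map
  · simpa using IsEvenEdgeSet.six_le_card h3 h5 (heven p) (heven q)
      ((Finset.map_injective _).ne hpq) (Finset.mem_map_of_mem _ hp) (Finset.mem_map_of_mem _ hq)
      (by simpa using hcard)
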